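/- Let $S$ be a monoid, let $G$ be a group, and let $\sigma\colon S\to \mathrm{End}(G)$ be a faithful algebraic action, i.e. an injective monoid homomorphism such that every $\sigma_s$ is an injective endomorphism of $G$. Assume that $\sigma$ is non-automorphic, i.e. some $\sigma_s$ is not an automorphism of $G$. \emph{Semigroups and subgroups.} Let $I$ be the inverse semigroup of partial bijections of $G$ generated by the maps $\sigma_s$ ($s\in S$) and the left translations $h\mapsto gh$ ($g\in G$), and let $I^e\subseteq I$ be the inverse subsemigroup generated by the $\sigma_s$. Let $\mathcal E$ be the idempotent semilattice of $I$; each idempotent is identified with its domain, so that $\mathcal E$ is a family of subsets of $G$ with product $\cap$. Let $\mathcal C$ be the smallest family of subgroups of $G$ that contains $G$ and satisfies $\sigma_s(C)\in\mathcal C$ and $\sigma_s^{-1}(C)\in\mathcal C$ for all $C\in\mathcal C$, $s\in S$; then $gC\in\mathcal E$ for all $g\in G$, $C\in\mathcal C$. \emph{The boundary.} Let $\widehat{\mathcal E}$ be the space of characters of $\mathcal E$, i.e. of non-zero multiplicative maps $\chi\colon\mathcal E\to\{0,1\}$ with $\chi(\emptyset)=0$, with the topology of pointwise convergence. Let $\widehat{\mathcal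 E}_{\max}$ be the set of those $\chi$ for which $\{X\in\mathcal E:\chi(X)=1\}$ is maximal with respect to inclusion among the sets of this form, and let $\partial\widehat{\mathcal E}$ be the closure of $\widehat{\mathcal E}_{\max}$ in $\widehat{\mathcal E}$. For $\phi\in I$ and $\chi\in\widehat{\mathcal E}$ with $\chi(\mathrm{dom}(\phi))=1$, let $\phi.\chi\in\widehat{\mathcal E}$ be given by $(\phi.\chi)(X)=\chi(\phi^{-1}(X))$, where $\phi^{-1}(X)=\{x\in\mathrm{dom}(\phi):\phi(x)\in X\}$. A subset $\mathfrak X\subseteq\partial\widehat{\mathcal E}$ is \emph{invariant} if $\phi.\chi\in\mathfrak X$ for all $\chi\in\mathfrak X$ and $\phi\in I$ with $\chi(\mathrm{dom}(\phi))=1$. \emph{Filters on $\mathcal C$.} A filter on $\mathcal C$ is a subset $\mathfrak F\subseteq\mathcal C$ that contains $G$, contains every $D\in\mathcal C$ that contains some $C\in\mathfrak F$, and is closed under intersections of two elements. It is \emph{finitely hereditary} if $D\in\mathfrak F$ whenever $C\in\mathfrak F$, $D\in\mathcal C$, $D\subseteq C$ and $[C:D]<\infty$. Let $\boldsymbol{\mathfrak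 F}_{\mathcal C}$ be the set of finitely hereditary filters on $\mathcal C$. For $\mathfrak F\in\boldsymbol{\mathfrak F}_{\mathcal C}$ and $\varphi\in I^e$, say that $\varphi.\mathfrak F$ is defined if there is $K\in\mathfrak F$ with $K\subseteq\mathrm{dom}(\varphi)$; in that case $\varphi.\mathfrak F$ is the smallest element of $\boldsymbol{\mathfrak F}_{\mathcal C}$ containing $\{\varphi(K\cap C):C\in\mathfrak F\}$. A subset $\boldsymbol{\mathfrak F}\subseteq\boldsymbol{\mathfrak F}_{\mathcal C}$ is \emph{$I^e$-invariant} if $\varphi.\mathfrak F\in\boldsymbol{\mathfrak F}$ for all $\mathfrak F\in\boldsymbol{\mathfrak F}$ and $\varphi\in I^e$ such that $\varphi.\mathfrak F$ is defined. It is \emph{$\subseteq$-closed} if every $\mathfrak E\in\boldsymbol{\mathfrak F}_{\mathcal C}$ with $\mathfrak E\subseteq\bigcup_{\mathfrak F\in\boldsymbol{\mathfrak F}}\mathfrak F$ belongs to $\boldsymbol{\mathfrak F}$. For $\chi\in\widehat{\mathcal E}$ put $\mathfrak F(\chi)=\{C\in\mathcal C:\chi(gC)=1\text{ for some }g\in G\}$.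 \textbf{Theorem.} The map $\mathfrak X\mapsto\{\mathfrak F(\chi):\chi\in\mathfrak X\}$ is a bijection from the set of closed invariant subspaces $\mathfrak X$ of $\partial\widehat{\mathcal E}$ onto the set of $I^e$-invariant, $\subseteq$-closed subsets of $\boldsymbol{\mathfrak F}_{\mathcal C}$. Its inverse sends $\boldsymbol{\mathfrak F}$ to $\{\chi\in\partial\widehat{\mathcal E}:\mathfrak F(\chi)\in\boldsymbol{\mathfrak F}\}$. -/

import Mathlib

open scoped Pointwise

/-- A faithful algebraic action of a monoid `S` on a (discrete) group `G`: an injective monoid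
homomorphism from `S` to the endomorphisms of `G`, all of whose values are injective. -/
structure AlgebraicAction (S G : Type*) [Monoid S] [Group G] where
  toHom : S →* Monoid.End G
  injective : ∀ s, Function.Injective (toHom s)
  faithful : Function.Injective toHom

namespace AlgebraicAction

/-- The domain of a partial bijection. -/
def dom {G : Type*} (φ : G ≃. G) : Set G := {x | ∃ y, y ∈ φ x}

/-- The image `φ(X ∩ dom φ)`. -/
def image {G : Type*} (φ : G ≃. G) (X : Set G) : Set G := {y | ∃ x ∈ X, y ∈ φ x}

/-- The preimage `φ⁻¹(X) = {x ∈ dom φ | φ x ∈ X}`. -/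
def preimage {G : Type*} (φ : G ≃. G) (X : Set G) : Set G := {x | ∃ y ∈ X, y ∈ φ x}

theorem eq_of_idem {G : Type*} {φ : G ≃. G} (h : φ.trans φ = φ) {x y : G} (hy : y ∈ φ x) : y = x := by
  have h1 : y ∈ (φ.trans φ) x := by rw [h]; exact hy
  obtain ⟨z, hz, hz'⟩ := (PEquiv.mem_trans φ φ x y).1 h1
  have hzy : z = y := Option.mem_unique hz hy
  subst hzy
  exact PEquiv.inj φ hz' hz

theorem idem_of_eq {G : Type*} {φ : G ≃. G} (h : ∀ x y, y ∈ φ x → y = x) : φ.trans φ = φ := by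
  ext x y
  rw [← Option.mem_def, ← Option.mem_def, PEquiv.mem_trans]
  constructor
  · rintro ⟨z, hz, hz'⟩
    have := h _ _ hz
    subst this
    exact hz'
  · intro hy
    have := h _ _ hy
    subst this
    exact ⟨_, hy, hy⟩

variable {S G : Type*} [Monoid S] [Group G] (σ : AlgebraicAction S G)

/-- The action is non-automorphic if some `σ s` is not an automorphism of `G`
(equivalently, is not surjective). -/
def NonAutomorphic : Prop := ∃ s, ¬ Function.Bijective (σ.toHom s)

/-- `σ s`, viewed as a partial bijection of `G` with domain `G` and range `σ s (G)`. -/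
noncomputable def endo (s : S) : G ≃. G where
  toFun g := some (σ.toHom s g)
  invFun := Function.partialInv (σ.toHom s)
  inv a b := by
    simpa [eq_comm] using (σ.injective s).isPartialInv a b

/-- Left translation by `g`, as a partial bijection of `G`. -/
def translation (g : G) : G ≃. G := (Equiv.mulLeft g).toPEquiv

/-- The inverse semigroup `I` of partial bijections of `G` generated by the `σ s` and the
translations. The product `φ ψ` (first `ψ`, then `φ`) is `ψ.trans φ`. -/
inductive MemI : (G ≃. G) → Prop
  | endo (s : S) : MemI (σ.endo s)
  | translation (g : G) : MemI (translation g)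
  | symm {φ : G ≃. G} : MemI φ → MemI φ.symm
  | mul {φ ψ : G ≃. G} : MemI φ → MemI ψ → MemI (ψ.trans φ)

/-- The inverse semigroup `Iᵉ` of partial bijections of `G` generated by the `σ s`. -/
inductive MemIe : (G ≃. G) → Prop
  | endo (s : S) : MemIe (σ.endo s)
  | symm {φ : G ≃. G} : MemIe φ → MemIe φ.symm
  | mul {φ ψ : G ≃. G} : MemIe φ → MemIe ψ → MemIe (ψ.trans φ)

/-- The idempotent semilattice `ℰ` of `I`. An idempotent partial bijection is the identity of its
domain, and is identified with that domain; the product of idempotents becomes intersection. -/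
def idem : Set (Set G) := {X | ∃ φ, σ.MemI φ ∧ φ.trans φ = φ ∧ dom φ = X}

/-- The `S`-constructible subgroups `𝒞`: the smallest family of subgroups of `G` that contains `G`
and is closed under images and preimages with respect to the `σ s`. -/
inductive IsConstructible : Subgroup G → Prop
  | top : IsConstructible ⊤
  | map (s : S) {C : Subgroup G} :
      IsConstructible C → IsConstructible (C.map (σ.toHom s : G →* G))
  | comap (s : S) {C : Subgroup G} :
      IsConstructible C → IsConstructible (C.comap (σ.toHom s : G →* G))

section Lemmas

variable {σ}

theorem dom_mem_idem {φ : G ≃. G} (h : σ.MemI φ) : dom φ ∈ σ.idem := by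
  refine ⟨φ.trans φ.symm, h.symm.mul h, idem_of_eq ?_, ?_⟩
  · intro x y hy
    obtain ⟨z, hz, hz'⟩ := (PEquiv.mem_trans _ _ _ _).1 hy
    exact PEquiv.inj φ (φ.mem_iff_mem.1 hz') hz
  · ext x
    constructor
    · rintro ⟨y, hy⟩
      obtain ⟨z, hz, -⟩ := (PEquiv.mem_trans _ _ _ _).1 hy
      exact ⟨z, hz⟩
    · rintro ⟨y, hy⟩
      exact ⟨x, (PEquiv.mem_trans _ _ _ _).2 ⟨y, hy, φ.mem_iff_mem.2 hy⟩⟩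

theorem preimage_mem_idem {φ : G ≃. G} (h : σ.MemI φ) {X : Set G} (hX : X ∈ σ.idem) :
    preimage φ X ∈ σ.idem := by
  obtain ⟨ψ, hψ, hi, rfl⟩ := hX
  convert dom_mem_idem (hψ.mul h) using 1
  ext x
  constructor
  · rintro ⟨y, ⟨z, hz⟩, hy⟩
    exact ⟨z, (PEquiv.mem_trans _ _ _ _).2 ⟨y, hy, hz⟩⟩
  · rintro ⟨z, hz⟩
    obtain ⟨y, hy, hz⟩ := (PEquiv.mem_trans _ _ _ _).1 hz
    exact ⟨y, ⟨z, hz⟩, hy⟩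

theorem inter_mem_idem {X Y : Set G} (hX : X ∈ σ.idem) (hY : Y ∈ σ.idem) :
    X ∩ Y ∈ σ.idem := by
  obtain ⟨ψ, hψ, hi, rfl⟩ := hX
  convert preimage_mem_idem hψ hY using 1
  ext x
  constructor
  · rintro ⟨⟨y, hy⟩, hx⟩
    have := eq_of_idem hi hy
    subst this
    exact ⟨_, hx, hy⟩
  · rintro ⟨y, hx, hy⟩
    have := eq_of_idem hi hy
    subst this
    exact ⟨⟨_, hy⟩, hx⟩

theorem smul_mem_idem {C : Subgroup G} (hC : σ.IsConstructible C) (g : G) :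
    g • (C : Set G) ∈ σ.idem := by
  have key : (C : Set G) ∈ σ.idem := by
    induction hC with
    | top =>
      convert dom_mem_idem (MemI.translation (σ := σ) 1) using 1
      ext x
      simp [dom, AlgebraicAction.translation]
    | map s _ ih =>
      convert preimage_mem_idem (MemI.endo (σ := σ) s).symm ih using 1
      ext x
      simp only [preimage, Set.mem_ofPred_eq, PEquiv.mem_iff_mem]
      simp only [AlgebraicAction.endo, PEquiv.coe_mk, Option.mem_some_iff]
      exact Iff.rfl
    | comap s _ ih =>
      convert preimage_mem_idem (MemI.endo (σ := σ) s) ih using 1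
      ext x
      simp only [preimage, Set.mem_ofPred_eq, AlgebraicAction.endo, PEquiv.coe_mk,
        Option.mem_some_iff, exists_eq_right']
      exact Iff.rfl
  convert preimage_mem_idem (MemI.translation (σ := σ) g⁻¹) key using 1
  ext x
  simp [preimage, AlgebraicAction.translation, Set.mem_smul_set_iff_inv_smul_mem]

end Lemmas

/-- A character of `ℰ`: a non-zero multiplicative map `ℰ → {0, 1}` sending `∅` to `0`. -/
def IsCharacter (χ : σ.idem → Bool) : Prop :=
  (∃ X, χ X = true) ∧
  (∀ X Y : σ.idem, χ ⟨X.1 ∩ Y.1, inter_mem_idem X.2 Y.2⟩ = (χ X && χ Y)) ∧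
  ∀ h : ∅ ∈ σ.idem, χ ⟨∅, h⟩ = false

/-- The space of characters of `ℰ`, with the topology of pointwise convergence. -/
abbrev Spectrum : Type _ := {χ : σ.idem → Bool // σ.IsCharacter χ}

variable {σ}

/-- The filter on `ℰ` of a character. -/
def filterOf (χ : σ.Spectrum) : Set σ.idem := {X | χ.1 X = true}

/-- The characters whose filter is maximal with respect to inclusion. -/
def maxSpectrum (σ : AlgebraicAction S G) : Set σ.Spectrum :=
  {χ | ¬ ∃ χ' : σ.Spectrum, filterOf χ ⊂ filterOf χ'}

/-- The boundary of the spectrum: the closure of the set of characters with maximal filter. -/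
def boundary (σ : AlgebraicAction S G) : Set σ.Spectrum := closure σ.maxSpectrum

/-- For `φ ∈ I` and a character `χ` with `χ (dom φ) = 1`, the character `φ.χ = χ (φ⁻¹ ⬝ φ)`; on the
idempotent with domain `X`, this is `χ` of the idempotent with domain `φ⁻¹(X)`. -/
def act {φ : G ≃. G} (hφ : σ.MemI φ) (χ : σ.Spectrum)
    (hχ : χ.1 ⟨dom φ, dom_mem_idem hφ⟩ = true) : σ.Spectrum :=
  ⟨fun X => χ.1 ⟨preimage φ X.1, preimage_mem_idem hφ X.2⟩, by
    have hs := dom_mem_idem hφ.symm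
    refine ⟨⟨⟨dom φ.symm, hs⟩, ?_⟩, ?_, ?_⟩
    · rw [← hχ]
      refine congrArg χ.1 (Subtype.ext (Set.ext fun x => ?_))
      constructor
      · rintro ⟨y, -, hy⟩
        exact ⟨y, hy⟩
      · rintro ⟨y, hy⟩
        exact ⟨y, ⟨x, φ.mem_iff_mem.2 hy⟩, hy⟩
    · intro X Y
      rw [← χ.2.2.1]
      refine congrArg χ.1 (Subtype.ext (Set.ext fun x => ?_))
      constructor
      · rintro ⟨y, ⟨hX, hY⟩, hy⟩
        exact ⟨⟨y, hX, hy⟩, ⟨y, hY, hy⟩⟩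
      · rintro ⟨⟨y, hX, hy⟩, ⟨z, hZ, hz⟩⟩
        have := Option.mem_unique hy hz
        subst this
        exact ⟨y, ⟨hX, hZ⟩, hy⟩
    · intro h
      rw [← χ.2.2.2 h]
      refine congrArg χ.1 (Subtype.ext (Set.ext fun x => ?_))
      simp [preimage]⟩

/-- A set of characters is invariant if it is mapped into itself by the action of `I`. -/
def IsInvariant (X : Set σ.Spectrum) : Prop :=
  ∀ χ ∈ X, ∀ (φ : G ≃. G) (hφ : σ.MemI φ) (hχ : χ.1 ⟨dom φ, dom_mem_idem hφ⟩ = true),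
    act hφ χ hχ ∈ X

/-- The closed invariant subspaces of the boundary. (The boundary is closed, so a subset of it is
closed in the boundary if and only if it is closed in the spectrum.) -/
def closedInvariantSubspaces (σ : AlgebraicAction S G) : Set (Set σ.Spectrum) :=
  {X | X ⊆ σ.boundary ∧ IsClosed X ∧ IsInvariant X}

/-- `𝔉(χ)`: the constructible subgroups `C` with `χ (g C) = 1` for some `g`. -/
def constructibleFilter (χ : σ.Spectrum) : Set (Subgroup G) :=
  {C | ∃ (hC : σ.IsConstructible C) (g : G), χ.1 ⟨g • (C : Set G), smul_mem_idem hC g⟩ = true}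

/-- Filters on the semilattice of constructible subgroups. -/
structure IsFilter (σ : AlgebraicAction S G) (F : Set (Subgroup G)) : Prop where
  constructible : ∀ C ∈ F, σ.IsConstructible C
  top_mem : ⊤ ∈ F
  upward : ∀ C ∈ F, ∀ D, σ.IsConstructible D → C ≤ D → D ∈ F
  inf_mem : ∀ C ∈ F, ∀ D ∈ F, C ⊓ D ∈ F

/-- The set of finitely hereditary filters on the constructible subgroups: if `C ∈ F`, then `F`
contains every constructible subgroup of finite index in `C`. -/
def finHereditaryFilters (σ : AlgebraicAction S G) : Set (Set (Subgroup G)) :=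
  {F | σ.IsFilter F ∧
    ∀ C ∈ F, ∀ D, σ.IsConstructible D → D ≤ C → D.IsFiniteRelIndex C → D ∈ F}

/-- `φ.F` is defined and equal to `F'`: there is a `K ∈ F` with `K ⊆ dom φ`, and `F'` is the
smallest finitely hereditary filter containing `φ(K ∩ C)` for all `C ∈ F`. -/
def IsTranslate (σ : AlgebraicAction S G) (φ : G ≃. G) (F F' : Set (Subgroup G)) : Prop :=
  ∃ K ∈ F, (K : Set G) ⊆ dom φ ∧
    IsLeast {E | E ∈ σ.finHereditaryFilters ∧
      ∀ C ∈ F, ∃ D ∈ E, (D : Set G) = image φ ((K : Set G) ∩ C)} F'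

/-- The `Iᵉ`-invariant, `⊆`-closed sets of finitely hereditary filters. -/
def invariantClosedFamilies (σ : AlgebraicAction S G) : Set (Set (Set (Subgroup G))) :=
  {Fs | Fs ⊆ σ.finHereditaryFilters ∧
    (∀ F ∈ Fs, ∀ φ, σ.MemIe φ → ∀ F', σ.IsTranslate φ F F' → F' ∈ Fs) ∧
    ∀ E ∈ σ.finHereditaryFilters, E ⊆ ⋃₀ Fs → E ∈ Fs}

end AlgebraicAction

/-! Every `φ ∈ I` is, around each point of its domain, a translate of one element `ψ ∈ Iᵉ`, so the
non-empty members of `ℰ` are exactly the cosets `gC` of constructible subgroups. A character selects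
at most one coset of each `C`, and `𝔉(χ)` records for which `C` it selects one.

The core is `mem_closure_of_constructibleFilter_subset`: if `X` is translation invariant, `𝔉(ψ)` is
finitely hereditary and `𝔉(ψ) ⊆ ⋃ 𝔉(χ)` over `χ ∈ X`, then `ψ ∈ closure X`. Given finitely many
cosets, some translate of a suitable `χ` agrees with `ψ` on those whose subgroup lies in `𝔉(ψ)`. The
translating element can still be varied within a subgroup `C ∈ 𝔉(ψ)`; the other cosets each exclude
at most a coset of a subgroup of infinite relative index in `C`, and by Neumann's lemma these do not
exhaust `C`.

Together with a covering property of maximal characters, this shows that the boundary consists of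
the `χ` with `𝔉(χ)` finitely hereditary. Also `𝔉(φ.χ) = ψ.𝔉(χ)`, which matches the two notions of
invariance, and every filter is some `𝔉(χ)`. The core lemma then says that a closed invariant set is
determined by its filters and that `⊆`-closedness corresponds to closedness. -/

/-! ### Cosets and finite relative index -/

theorem mem_smul_subgroup {G : Type*} [Group G] {C : Subgroup G} {g x : G} :
    x ∈ g • (C : Set G) ↔ g⁻¹ * x ∈ C := by
  rw [Set.mem_smul_set_iff_inv_smul_mem, smul_eq_mul, SetLike.mem_coe]

theorem smul_subgroup_eq_of_mem {G : Type*} [Group G] {C : Subgroup G} {g x : G}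
    (h : x ∈ g • (C : Set G)) : g • (C : Set G) = x • (C : Set G) := by
  rw [mem_smul_subgroup] at h
  ext y
  rw [mem_smul_subgroup, mem_smul_subgroup]
  simpa [mul_assoc] using C.mul_mem_cancel_left (y := x⁻¹ * y) h

theorem mem_smul_subgroup_self {G : Type*} [Group G] (C : Subgroup G) (g : G) :
    g ∈ g • (C : Set G) := by
  simp [mem_smul_subgroup]

theorem smul_subgroup_inter {G : Type*} [Group G] (C D : Subgroup G) (g : G) :
    g • (C : Set G) ∩ g • (D : Set G) = g • ((C ⊓ D : Subgroup G) : Set G) := by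
  ext y
  simp only [Set.mem_inter_iff, mem_smul_subgroup, Subgroup.mem_inf]

/-- **Neumann's lemma**: a group is not covered by finitely many cosets of subgroups
of infinite index. -/
theorem Subgroup.exists_mem_forall_notMem_coset {G ι : Type*} [Group G] (C : Subgroup G)
    (s : Finset ι) (x : ι → G) (K : ι → Subgroup G)
    (hK : ∀ i ∈ s, ¬ (K i).IsFiniteRelIndex C) :
    ∃ c ∈ C, ∀ i ∈ s, (x i)⁻¹ * c ∉ K i := by
  by_contra! h
  -- Recentre each coset at a point of `C`, so that the cover becomes one of the group `C` by cosets
  -- of `K i ∩ C`. A coset missing `C` gets the harmless representative `1`.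
  have hy : ∀ i, ∃ y : C, ∀ c ∈ C, (x i)⁻¹ * c ∈ K i → (x i)⁻¹ * y ∈ K i := fun i => by
    by_cases hi : ∃ c ∈ C, (x i)⁻¹ * c ∈ K i
    · obtain ⟨c, hc, hc'⟩ := hi
      exact ⟨⟨c, hc⟩, fun _ _ _ => hc'⟩
    · push Not at hi
      exact ⟨1, fun c hc hc' => absurd hc' (hi c hc)⟩
  choose y hy using hy
  obtain ⟨k, hk, hfin⟩ := Subgroup.exists_finiteIndex_of_leftCoset_cover
    (s := s) (g := y) (H := fun i => (K i).subgroupOf C) (by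
      refine Set.eq_univ_of_forall fun c => ?_
      obtain ⟨i, hi, hc⟩ := h c c.2
      refine Set.mem_biUnion hi ?_
      rw [mem_smul_subgroup, Subgroup.mem_subgroupOf]
      have := (K i).mul_mem ((K i).inv_mem (hy i c c.2 hc)) hc
      simpa [mul_assoc] using this)
  exact hK k hk (Subgroup.isFiniteRelIndex_iff_finiteIndex.2 hfin)

/-- The representatives need not lie in `C`, nor `D` in `C`; the converse is Neumann's lemma for
cosets of the single subgroup `D`. -/
theorem Subgroup.isFiniteRelIndex_iff_exists_finset {G : Type*} [Group G] {C D : Subgroup G} :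
    D.IsFiniteRelIndex C ↔ ∃ T : Finset G, ∀ c ∈ C, ∃ t ∈ T, t⁻¹ * c ∈ D := by
  classical
  constructor
  · intro h
    have : Finite (C ⧸ D.subgroupOf C) := inferInstance
    have := Fintype.ofFinite (C ⧸ D.subgroupOf C)
    refine ⟨Finset.univ.image fun q : C ⧸ D.subgroupOf C => (q.out : G), fun c hc => ?_⟩
    refine ⟨_, Finset.mem_image_of_mem _ (Finset.mem_univ ((⟨c, hc⟩ : C) : C ⧸ D.subgroupOf C)),
      ?_⟩
    have h2 : ((((⟨c, hc⟩ : C) : C ⧸ D.subgroupOf C).out : C) : C ⧸ D.subgroupOf C)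
      = (⟨c, hc⟩ : C) := Quotient.out_eq' _
    rw [QuotientGroup.eq] at h2
    exact h2
  · rintro ⟨T, hT⟩
    by_contra h
    obtain ⟨c, hc, hc'⟩ := C.exists_mem_forall_notMem_coset T id (fun _ => D) fun _ _ => h
    obtain ⟨t, ht, h'⟩ := hT c hc
    exact hc' t ht h'

theorem Subgroup.isFiniteRelIndex_conj_smul {G : Type*} [Group G] {C D : Subgroup G} {k : G}
    (hk : k ∈ C) : (MulAut.conj k • D).IsFiniteRelIndex C ↔ D.IsFiniteRelIndex C := by
  rw [isFiniteRelIndex_iff_relIndex_ne_zero, isFiniteRelIndex_iff_relIndex_ne_zero]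
  nth_rw 1 [← Subgroup.conj_smul_eq_self_of_mem hk]
  rw [Subgroup.relIndex_pointwise_smul]

namespace AlgebraicAction

variable {S G : Type*} [Monoid S] [Group G] {σ : AlgebraicAction S G}

/-! ### Constructible subgroups and `Iᵉ` -/

theorem mem_endo {s : S} {x y : G} : y ∈ σ.endo s x ↔ σ.toHom s x = y := by
  simp [endo]

theorem mem_translation {g x y : G} : y ∈ translation g x ↔ g * x = y := by
  simp [translation]

theorem MemIe.memI {φ : G ≃. G} (h : σ.MemIe φ) : σ.MemI φ := by
  induction h with
  | endo s => exact .endo s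
  | symm _ ih => exact ih.symm
  | mul _ _ ih ih' => exact ih.mul ih'

theorem preimage_trans {G : Type*} (φ ψ : G ≃. G) (X : Set G) :
    preimage (ψ.trans φ) X = preimage ψ (preimage φ X) := by
  ext x
  constructor
  · rintro ⟨z, hz, hxz⟩
    obtain ⟨y, hy, hyz⟩ := (PEquiv.mem_trans _ _ _ _).1 hxz
    exact ⟨y, ⟨z, hz, hyz⟩, hy⟩
  · rintro ⟨y, ⟨z, hz, hyz⟩, hy⟩
    exact ⟨z, hz, (PEquiv.mem_trans _ _ _ _).2 ⟨y, hy, hyz⟩⟩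

theorem preimage_univ {G : Type*} (φ : G ≃. G) : preimage φ Set.univ = dom φ := by
  ext x
  simp [preimage, dom]

/-- Treating `φ` and `φ.symm` together lets the induction pass through inverses. -/
theorem MemIe.preimage_constructible {φ : G ≃. G} (h : σ.MemIe φ) :
    (∀ C, σ.IsConstructible C → ∃ D, σ.IsConstructible D ∧ (D : Set G) = preimage φ C) ∧
    ∀ C, σ.IsConstructible C → ∃ D, σ.IsConstructible D ∧ (D : Set G) = preimage φ.symm C := by
  induction h with
  | endo s =>
    refine ⟨fun C hC => ⟨_, hC.comap s, ?_⟩, fun C hC => ⟨_, hC.map s, ?_⟩⟩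
    · ext x
      simp only [preimage, mem_endo, Set.mem_ofPred_eq, exists_eq_right']
      exact Iff.rfl
    · ext x
      simp only [preimage, PEquiv.mem_iff_mem, mem_endo, Set.mem_ofPred_eq]
      exact Iff.rfl
  | symm _ ih => exact ⟨ih.2, by simpa using ih.1⟩
  | mul _ _ ih ih' =>
    constructor
    · intro C hC
      obtain ⟨D, hD, h⟩ := ih.1 C hC
      obtain ⟨E, hE, h'⟩ := ih'.1 D hD
      exact ⟨E, hE, by rw [preimage_trans, ← h, h']⟩
    · intro C hC
      obtain ⟨D, hD, h⟩ := ih'.2 C hC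
      obtain ⟨E, hE, h'⟩ := ih.2 D hD
      exact ⟨E, hE, by rw [PEquiv.symm_trans_rev, preimage_trans, ← h, h']⟩

theorem memIe_refl : σ.MemIe (PEquiv.refl G) := by
  convert MemIe.endo (σ := σ) 1
  ext x y
  rw [← Option.mem_def, ← Option.mem_def, mem_endo]
  simp

/-- Conjugating the identity of `C` by `σ s` gives the identity of `σ s (C)`, and conjugating by its
inverse gives that of the preimage. Hence intersecting with `C` is taking a preimage under an
element of `Iᵉ`. -/
theorem IsConstructible.exists_memIe {C : Subgroup G} (hC : σ.IsConstructible C) :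
    ∃ φ, σ.MemIe φ ∧ ∀ x y, y ∈ φ x ↔ x = y ∧ x ∈ C := by
  induction hC with
  | top => exact ⟨_, memIe_refl, fun x y => by simp⟩
  | map s _ ih =>
    obtain ⟨φ, hφ, h⟩ := ih
    refine ⟨_, ((MemIe.endo s).mul hφ).mul (MemIe.endo s).symm, fun x y => ?_⟩
    simp only [PEquiv.mem_trans, PEquiv.mem_iff_mem, mem_endo, h]
    constructor
    · rintro ⟨z, rfl, _, ⟨rfl, hz⟩, rfl⟩
      exact ⟨rfl, z, hz, rfl⟩
    · rintro ⟨rfl, z, hz, rfl⟩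
      exact ⟨z, rfl, z, ⟨rfl, hz⟩, rfl⟩
  | comap s _ ih =>
    obtain ⟨φ, hφ, h⟩ := ih
    refine ⟨_, ((MemIe.endo s).symm.mul hφ).mul (MemIe.endo s), fun x y => ?_⟩
    simp only [PEquiv.mem_trans, PEquiv.mem_iff_mem, mem_endo, h]
    constructor
    · rintro ⟨_, rfl, _, ⟨rfl, hz⟩, hy⟩
      exact ⟨(σ.injective s hy).symm, hz⟩
    · rintro ⟨rfl, hz⟩
      exact ⟨_, rfl, _, ⟨rfl, hz⟩, rfl⟩

theorem IsConstructible.inf {C D : Subgroup G} (hC : σ.IsConstructible C)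
    (hD : σ.IsConstructible D) : σ.IsConstructible (C ⊓ D) := by
  obtain ⟨φ, hφ, h⟩ := hC.exists_memIe
  obtain ⟨E, hE, h'⟩ := hφ.preimage_constructible.1 D hD
  convert hE
  refine SetLike.coe_injective (Eq.trans ?_ h'.symm)
  ext x
  simp only [preimage, h, Subgroup.coe_inf, Set.mem_inter_iff, SetLike.mem_coe,
    Set.mem_ofPred_eq]
  constructor
  · rintro ⟨h1, h2⟩
    exact ⟨x, h2, rfl, h1⟩
  · rintro ⟨_, h2, rfl, h1⟩
    exact ⟨h1, h2⟩

/-! ### Linear parts, and `ℰ` as a family of cosets -/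

/-- `ψ` is the partial homomorphism that `φ` is equal to, up to translations, around each point
of its domain. -/
def IsLinearPart (ψ φ : G ≃. G) : Prop :=
  ∀ x y, y ∈ φ x → ∀ c z, z ∈ φ (x * c) ↔ y⁻¹ * z ∈ ψ c

theorem IsLinearPart.symm {φ ψ : G ≃. G} (h : IsLinearPart ψ φ) :
    IsLinearPart ψ.symm φ.symm := by
  intro x y hy c z
  rw [PEquiv.mem_iff_mem] at hy ⊢
  rw [PEquiv.mem_iff_mem]
  simpa using h y x hy (y⁻¹ * z) (x * c)

theorem IsLinearPart.trans {φ ψ φ' ψ' : G ≃. G} (h : IsLinearPart ψ φ)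
    (h' : IsLinearPart ψ' φ') : IsLinearPart (ψ'.trans ψ) (φ'.trans φ) := by
  intro x z hz c w
  obtain ⟨y, hy, hz⟩ := (PEquiv.mem_trans _ _ _ _).1 hz
  simp only [PEquiv.mem_trans, h' x y hy]
  constructor
  · rintro ⟨v, hv, hw⟩
    refine ⟨_, hv, (h y z hz _ _).1 ?_⟩
    simpa using hw
  · rintro ⟨v, hv, hw⟩
    exact ⟨y * v, by simpa using hv, (h y z hz _ _).2 hw⟩

theorem isLinearPart_endo (s : S) : IsLinearPart (σ.endo s) (σ.endo s) := by
  intro x y hy c z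
  rw [mem_endo] at *
  subst hy
  rw [mem_endo, map_mul, eq_inv_mul_iff_mul_eq]

theorem MemIe.isLinearPart {φ : G ≃. G} (h : σ.MemIe φ) : IsLinearPart φ φ := by
  induction h with
  | endo s => exact isLinearPart_endo s
  | symm _ ih => exact ih.symm
  | mul _ _ ih ih' => exact ih.trans ih'

/-- Linear parts are compatible with inverses and products; that of a translation is the identity,
so only the `σ s` contribute. -/
theorem MemI.exists_isLinearPart {φ : G ≃. G} (h : σ.MemI φ) :
    ∃ ψ, σ.MemIe ψ ∧ IsLinearPart ψ φ := by
  induction h with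
  | endo s => exact ⟨_, .endo s, isLinearPart_endo s⟩
  | translation g =>
    refine ⟨_, memIe_refl, fun x y hy c z => ?_⟩
    rw [mem_translation] at hy
    subst hy
    rw [mem_translation]
    simp [mul_assoc, eq_inv_mul_iff_mul_eq, eq_comm]
  | symm _ ih =>
    obtain ⟨ψ, hψ, h⟩ := ih
    exact ⟨_, hψ.symm, h.symm⟩
  | mul _ _ ih ih' =>
    obtain ⟨ψ, hψ, h⟩ := ih
    obtain ⟨ψ', hψ', h'⟩ := ih'
    exact ⟨_, hψ.mul hψ', h.trans h'⟩

theorem IsLinearPart.preimage_smul {φ ψ : G ≃. G} (h : IsLinearPart ψ φ) {x y : G}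
    (hy : y ∈ φ x) (C : Subgroup G) :
    preimage φ (y • (C : Set G)) = x • preimage ψ C := by
  ext z
  rw [Set.mem_smul_set_iff_inv_smul_mem, smul_eq_mul]
  constructor
  · rintro ⟨w, hw, hzw⟩
    refine ⟨y⁻¹ * w, mem_smul_subgroup.1 hw, (h x y hy _ _).1 ?_⟩
    simpa using hzw
  · rintro ⟨w, hw, hzw⟩
    refine ⟨y * w, mem_smul_subgroup.2 (by simpa using hw), ?_⟩
    have := (h x y hy (x⁻¹ * z) (y * w)).2 (by simpa using hzw)
    simpa using this

theorem IsLinearPart.dom_eq {φ ψ : G ≃. G} (h : IsLinearPart ψ φ) {x : G}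
    (hx : x ∈ dom φ) : dom φ = x • dom ψ := by
  obtain ⟨y, hy⟩ := hx
  have := h.preimage_smul hy ⊤
  rwa [Subgroup.coe_top, Set.smul_set_univ, preimage_univ, preimage_univ] at this

theorem MemIe.dom_constructible {φ : G ≃. G} (h : σ.MemIe φ) :
    ∃ D, σ.IsConstructible D ∧ (D : Set G) = dom φ := by
  simpa [preimage_univ] using h.preimage_constructible.1 ⊤ .top

theorem eq_empty_or_smul_of_mem_idem {X : Set G} (hX : X ∈ σ.idem) :
    X = ∅ ∨ ∃ C, σ.IsConstructible C ∧ ∃ g : G, X = g • (C : Set G) := by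
  obtain ⟨φ, hφ, -, rfl⟩ := hX
  refine (dom φ).eq_empty_or_nonempty.imp_right ?_
  rintro ⟨x, hx⟩
  obtain ⟨ψ, hψ, h⟩ := hφ.exists_isLinearPart
  obtain ⟨D, hD, hD'⟩ := hψ.dom_constructible
  exact ⟨D, hD, x, by rw [hD', h.dom_eq hx]⟩

/-! ### Characters and their filters -/

/-- `χ(X) = 1`, for a set `X` that is not known to be in `ℰ`. -/
def Holds (χ : σ.Spectrum) (X : Set G) : Prop := ∃ h : X ∈ σ.idem, χ.1 ⟨X, h⟩ = true

theorem holds_iff {χ : σ.Spectrum} {X : Set G} (h : X ∈ σ.idem) :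
    Holds χ X ↔ χ.1 ⟨X, h⟩ = true :=
  ⟨fun ⟨_, h'⟩ => h', fun h' => ⟨h, h'⟩⟩

theorem Holds.inter {χ : σ.Spectrum} {X Y : Set G} (hX : Holds χ X) (hY : Holds χ Y) :
    Holds χ (X ∩ Y) := by
  obtain ⟨h, hX⟩ := hX
  obtain ⟨h', hY⟩ := hY
  refine ⟨inter_mem_idem h h', ?_⟩
  rw [χ.2.2.1 ⟨X, h⟩ ⟨Y, h'⟩, hX, hY, Bool.and_self]

theorem Holds.mono {χ : σ.Spectrum} {X Y : Set G} (hX : Holds χ X) (hY : Y ∈ σ.idem)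
    (hXY : X ⊆ Y) : Holds χ Y := by
  obtain ⟨h, hX⟩ := hX
  refine ⟨hY, ?_⟩
  have := χ.2.2.1 ⟨X, h⟩ ⟨Y, hY⟩
  simp only [Set.inter_eq_left.2 hXY, hX, Bool.true_and] at this
  exact this.symm

theorem Holds.nonempty {χ : σ.Spectrum} {X : Set G} (hX : Holds χ X) : X.Nonempty := by
  rw [Set.nonempty_iff_ne_empty]
  rintro rfl
  obtain ⟨h, hX⟩ := hX
  rw [χ.2.2.2 h] at hX
  cases hX

theorem univ_mem_idem : (Set.univ : Set G) ∈ σ.idem := by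
  simpa using smul_mem_idem (σ := σ) .top 1

theorem holds_univ (χ : σ.Spectrum) : Holds χ Set.univ := by
  obtain ⟨X, hX⟩ := χ.2.1
  exact Holds.mono ⟨X.2, hX⟩ univ_mem_idem (Set.subset_univ _)

theorem mem_constructibleFilter {χ : σ.Spectrum} {C : Subgroup G} :
    C ∈ constructibleFilter χ ↔ σ.IsConstructible C ∧ ∃ g : G, Holds χ (g • (C : Set G)) :=
  ⟨fun ⟨hC, g, h⟩ => ⟨hC, g, _, h⟩, fun ⟨hC, g, _, h⟩ => ⟨hC, g, h⟩⟩

theorem Holds.smul_eq {χ : σ.Spectrum} {C : Subgroup G} {g h : G}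
    (hg : Holds χ (g • (C : Set G))) (hh : Holds χ (h • (C : Set G))) :
    g • (C : Set G) = h • (C : Set G) := by
  obtain ⟨x, hx, hx'⟩ := (hg.inter hh).nonempty
  rw [smul_subgroup_eq_of_mem hx, smul_subgroup_eq_of_mem hx']

theorem isFilter_constructibleFilter (χ : σ.Spectrum) : σ.IsFilter (constructibleFilter χ) where
  constructible C hC := (mem_constructibleFilter.1 hC).1
  top_mem := mem_constructibleFilter.2 ⟨.top, 1, by simpa using holds_univ χ⟩
  upward C hC D hD hCD := by
    obtain ⟨-, g, hg⟩ := mem_constructibleFilter.1 hC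
    exact mem_constructibleFilter.2
      ⟨hD, g, hg.mono (smul_mem_idem hD g) (Set.smul_set_mono hCD)⟩
  inf_mem C hC D hD := by
    obtain ⟨hC, g, hg⟩ := mem_constructibleFilter.1 hC
    obtain ⟨hD, h, hh⟩ := mem_constructibleFilter.1 hD
    have hi := hg.inter hh
    obtain ⟨x, hx, hx'⟩ := hi.nonempty
    refine mem_constructibleFilter.2 ⟨hC.inf hD, x, ?_⟩
    rwa [smul_subgroup_eq_of_mem hx, smul_subgroup_eq_of_mem hx', smul_subgroup_inter] at hi

theorem IsFilter.finset_inf_mem {F : Set (Subgroup G)} (hF : σ.IsFilter F)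
    (T : Finset (Subgroup G)) (hT : ∀ D ∈ T, D ∈ F) : T.inf id ∈ F :=
  Finset.inf_induction hF.top_mem hF.inf_mem hT

open Classical in
/-- The character of a proper filter on `ℰ`. -/
noncomputable def ofFilter (f : Set (Set G)) (hf : ∃ X ∈ f, X ∈ σ.idem)
    (hf' : ∀ X ∈ σ.idem, ∀ Y ∈ σ.idem, X ∩ Y ∈ f ↔ X ∈ f ∧ Y ∈ f) (h0 : ∅ ∉ f) :
    σ.Spectrum :=
  ⟨fun X => decide (X.1 ∈ f), by
    refine ⟨?_, fun X Y => ?_, fun h => ?_⟩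
    · obtain ⟨X, hX, hX'⟩ := hf
      exact ⟨⟨X, hX'⟩, by simpa using hX⟩
    · rw [← Bool.decide_and]
      exact decide_eq_decide.2 (hf' _ X.2 _ Y.2)
    · simpa using h0⟩

theorem holds_ofFilter {f : Set (Set G)} {hf : ∃ X ∈ f, X ∈ σ.idem}
    {hf' : ∀ X ∈ σ.idem, ∀ Y ∈ σ.idem, X ∩ Y ∈ f ↔ X ∈ f ∧ Y ∈ f} {h0 : ∅ ∉ f} {X : Set G} :
    Holds (ofFilter (σ := σ) f hf hf' h0) X ↔ X ∈ σ.idem ∧ X ∈ f := by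
  constructor
  · rintro ⟨h, hX⟩
    exact ⟨h, by simpa [ofFilter] using hX⟩
  · rintro ⟨h, hX⟩
    exact ⟨h, by simpa [ofFilter] using hX⟩

/-- The members of `F`, as subsets of `G`, already form a proper filter on `ℰ`: a coset containing a
subgroup contains `1`, hence is itself a subgroup. -/
theorem IsFilter.exists_character {F : Set (Subgroup G)} (hF : σ.IsFilter F) :
    ∃ χ : σ.Spectrum, constructibleFilter χ = F := by
  refine ⟨ofFilter {X | ∃ C ∈ F, (C : Set G) = X} ⟨_, ⟨⊤, hF.top_mem, rfl⟩, ?_⟩ ?_ ?_, ?_⟩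
  · exact univ_mem_idem
  · intro X hX Y hY
    constructor
    · rintro ⟨C, hC, h⟩
      have key : ∀ Z ∈ σ.idem, (C : Set G) ⊆ Z → ∃ D ∈ F, (D : Set G) = Z := by
        intro Z hZ hCZ
        rcases eq_empty_or_smul_of_mem_idem hZ with rfl | ⟨D, hD, g, rfl⟩
        · exact absurd (hCZ C.one_mem) (Set.notMem_empty _)
        · have := smul_subgroup_eq_of_mem (hCZ C.one_mem)
          rw [one_smul] at this
          rw [this] at hCZ ⊢
          exact ⟨D, hF.upward C hC D hD hCZ, rfl⟩
      exact ⟨key X hX (h ▸ Set.inter_subset_left), key Y hY (h ▸ Set.inter_subset_right)⟩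
    · rintro ⟨⟨C, hC, rfl⟩, ⟨D, hD, rfl⟩⟩
      exact ⟨_, hF.inf_mem C hC D hD, rfl⟩
  · rintro ⟨C, hC, h⟩
    exact Set.notMem_empty (1 : G) (h ▸ SetLike.mem_coe.2 C.one_mem)
  · ext C
    simp only [mem_constructibleFilter, holds_ofFilter, Set.mem_ofPred_eq]
    constructor
    · rintro ⟨hC, g, -, D, hD, h⟩
      have := smul_subgroup_eq_of_mem (h ▸ D.one_mem : (1 : G) ∈ g • (C : Set G))
      rw [← h, one_smul] at this
      rwa [← SetLike.coe_injective this]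
    · intro hC
      have hC' := hF.constructible C hC
      exact ⟨hC', 1, smul_mem_idem hC' 1, C, hC, by simp⟩

/-! ### Topology, translates and the approximation lemma -/

theorem mem_closure_spectrum {X : Set σ.Spectrum} {ψ : σ.Spectrum} :
    ψ ∈ closure X ↔ ∀ T : Finset σ.idem, ∃ χ ∈ X, ∀ Z ∈ T, (Holds χ Z.1 ↔ Holds ψ Z.1) := by
  simp_rw [holds_iff (Subtype.mem _), ← Bool.eq_iff_iff]
  rw [mem_closure_iff]
  constructor
  · intro h T
    have ho : IsOpen (⋂ Z ∈ T, {χ : σ.Spectrum | χ.1 Z = ψ.1 Z}) :=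
      isOpen_biInter_finset fun Z _ =>
        (isOpen_discrete {ψ.1 Z}).preimage
          (f := fun χ : σ.Spectrum => χ.1 Z) ((continuous_apply Z).comp continuous_subtype_val)
    obtain ⟨χ, hχ, hχX⟩ := h _ ho (by simp)
    exact ⟨χ, hχX, by simpa using hχ⟩
  · rintro h o ho hψ
    obtain ⟨u, hu, rfl⟩ := isOpen_induced_iff.1 ho
    obtain ⟨T, v, hv, hvu⟩ := isOpen_pi_iff.1 hu ψ.1 hψ
    obtain ⟨χ, hχ, h⟩ := h T
    refine ⟨χ, hvu fun Z hZ => ?_, hχ⟩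
    rw [h Z hZ]
    exact (hv Z hZ).2

theorem holds_act {φ : G ≃. G} (hφ : σ.MemI φ) (χ : σ.Spectrum)
    (hχ : χ.1 ⟨dom φ, dom_mem_idem hφ⟩ = true) {X : Set G} :
    Holds (act hφ χ hχ) X ↔ X ∈ σ.idem ∧ Holds χ (preimage φ X) :=
  ⟨fun ⟨h, h'⟩ => ⟨h, _, h'⟩, fun ⟨h, _, h'⟩ => ⟨h, h'⟩⟩

theorem dom_translation (g : G) : dom (translation g) = Set.univ := by
  ext x
  simp only [dom, mem_translation, exists_eq', Set.mem_ofPred_eq, Set.mem_univ]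

theorem preimage_translation (g : G) (X : Set G) : preimage (translation g) X = g⁻¹ • X := by
  ext x
  simp only [preimage, mem_translation, exists_eq_right', Set.mem_ofPred_eq,
    Set.mem_smul_set_iff_inv_smul_mem, inv_inv, smul_eq_mul]

/-- The translate `g.χ` of a character. -/
def translate (g : G) (χ : σ.Spectrum) : σ.Spectrum :=
  act (.translation g) χ ((holds_iff _).1 (by rw [dom_translation]; exact holds_univ χ))

theorem smul_mem_idem_iff {g : G} {X : Set G} : g • X ∈ σ.idem ↔ X ∈ σ.idem := by
  have key : ∀ (g : G) (X : Set G), X ∈ σ.idem → g • X ∈ σ.idem := fun g X hX => by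
    simpa [preimage_translation] using preimage_mem_idem (.translation g⁻¹) hX
  exact ⟨fun h => by simpa using key g⁻¹ _ h, key g X⟩

theorem holds_translate {g : G} {χ : σ.Spectrum} {X : Set G} :
    Holds (translate g χ) X ↔ Holds χ (g⁻¹ • X) := by
  rw [translate, holds_act, preimage_translation, and_iff_right_iff_imp]
  rintro ⟨h, -⟩
  exact smul_mem_idem_iff.1 h

theorem holds_smul_iff_of_mem {χ : σ.Spectrum} {D : Subgroup G} {g h : G}
    (hg : Holds χ (g • (D : Set G))) : Holds χ (h • (D : Set G)) ↔ g⁻¹ * h ∈ D := by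
  constructor
  · intro hh
    rw [← mem_smul_subgroup, hg.smul_eq hh]
    exact mem_smul_subgroup_self D h
  · intro hh
    rwa [← smul_subgroup_eq_of_mem (mem_smul_subgroup.2 hh)]

theorem mem_closure_of_constructibleFilter_subset {X : Set σ.Spectrum}
    (hX : ∀ χ ∈ X, ∀ g, translate g χ ∈ X) {ψ : σ.Spectrum}
    (hψ : constructibleFilter ψ ∈ σ.finHereditaryFilters)
    (hψX : ∀ C ∈ constructibleFilter ψ, ∃ χ ∈ X, C ∈ constructibleFilter χ) :
    ψ ∈ closure X := by
  classical
  rw [mem_closure_spectrum]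
  intro T
  have hsub : ∃ D : σ.idem → Subgroup G, ∃ h : σ.idem → G, ∀ Z, Z.1 = ∅ ∨
      (σ.IsConstructible (D Z) ∧ Z.1 = h Z • (D Z : Set G)) := by
    have : ∀ Z : σ.idem, ∃ D : Subgroup G, ∃ h : G, Z.1 = ∅ ∨
      (σ.IsConstructible D ∧ Z.1 = h • (D : Set G)) := fun Z => by
      rcases eq_empty_or_smul_of_mem_idem Z.2 with h | ⟨D, hD, g, h⟩
      · exact ⟨⊤, 1, Or.inl h⟩
      · exact ⟨D, g, Or.inr ⟨hD, h⟩⟩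
    choose D h hD using this
    exact ⟨D, h, hD⟩
  obtain ⟨D, h, hD⟩ := hsub
  set E := constructibleFilter ψ
  have hEf := hψ.1
  set C := ((T.image D).filter (· ∈ E)).inf id
  have hC : C ∈ E := hEf.finset_inf_mem _ fun D hD => (Finset.mem_filter.1 hD).2
  have hCle : ∀ Z ∈ T, D Z ∈ E → C ≤ D Z := fun Z hZ hZE =>
    Finset.inf_le (f := id) (Finset.mem_filter.2 ⟨Finset.mem_image_of_mem _ hZ, hZE⟩)
  obtain ⟨hCc, g, hg⟩ := mem_constructibleFilter.1 hC
  obtain ⟨χ, hχ, hCχ⟩ := hψX C hC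
  obtain ⟨-, a, ha⟩ := mem_constructibleFilter.1 hCχ
  -- representatives in `C` of the cosets that `χ` selects
  have hk : ∀ Z, ∃ k ∈ C, D Z ∈ constructibleFilter χ →
      Holds χ ((a * k) • (D Z : Set G)) := fun Z => by
    by_cases hZ : D Z ∈ constructibleFilter χ
    · obtain ⟨-, b, hb⟩ := mem_constructibleFilter.1 hZ
      obtain ⟨x, hx, hx'⟩ := (ha.inter hb).nonempty
      refine ⟨a⁻¹ * x, mem_smul_subgroup.1 hx, fun _ => ?_⟩
      rwa [mul_inv_cancel_left, ← smul_subgroup_eq_of_mem hx']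
    · exact ⟨1, C.one_mem, fun h => absurd h hZ⟩
  choose k hkC hk using hk
  -- The translate of `χ` by `g * c * a⁻¹` selects `g c k D` whenever `χ` selects `a k D`. It is
  -- wrong at `h D` only if `c ∈ g⁻¹ h k⁻¹ (k D k⁻¹)`, so `c` must avoid these cosets of conjugates.
  obtain ⟨c, hc, hcT⟩ := C.exists_mem_forall_notMem_coset
    (T.filter fun Z => σ.IsConstructible (D Z) ∧ D Z ∉ E)
    (fun Z => g⁻¹ * h Z * (k Z)⁻¹) (fun Z => MulAut.conj (k Z) • D Z) (by
      intro Z hZ hfin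
      obtain ⟨-, hZc, hZE⟩ := Finset.mem_filter.1 hZ
      -- Finite relative index would make `D Z ⊓ C` of finite index in `C`; heredity would put it,
      -- and then `D Z`, into `E`.
      rw [Subgroup.isFiniteRelIndex_conj_smul (hkC Z),
        Subgroup.isFiniteRelIndex_iff_relIndex_ne_zero, ← Subgroup.inf_relIndex_right,
        ← Subgroup.isFiniteRelIndex_iff_relIndex_ne_zero] at hfin
      exact hZE (hEf.upward _ (hψ.2 C hC _ (hZc.inf hCc) inf_le_right hfin) _ hZc inf_le_left))
  refine ⟨translate (g * c * a⁻¹) χ, hX χ hχ _, fun Z hZ => ?_⟩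
  rw [holds_translate]
  rcases hD Z with h0 | ⟨hZc, hZD⟩
  · rw [h0, Set.smul_set_empty]
    exact ⟨fun h => absurd h.nonempty Set.not_nonempty_empty,
      fun h => absurd h.nonempty Set.not_nonempty_empty⟩
  rw [hZD, smul_smul]
  by_cases hZE : D Z ∈ E
  -- Here `c ∈ C ≤ D Z`, so `ψ` and the translate both select the coset of `g`.
  · have hle := hCle Z hZ hZE
    rw [holds_smul_iff_of_mem (hg.mono (smul_mem_idem hZc g) (Set.smul_set_mono hle)),
      holds_smul_iff_of_mem (ha.mono (smul_mem_idem hZc a) (Set.smul_set_mono hle)),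
      ← (D Z).mul_mem_cancel_left (hle hc)]
    simp [mul_assoc]
  · refine iff_of_false (fun hh => ?_) fun hh =>
      hZE (mem_constructibleFilter.2 ⟨hZc, _, hh⟩)
    have hZχ : D Z ∈ constructibleFilter χ := mem_constructibleFilter.2 ⟨hZc, _, hh⟩
    rw [holds_smul_iff_of_mem (hk Z hZχ)] at hh
    refine hcT Z (Finset.mem_filter.2 ⟨hZ, hZc, hZE⟩) ?_
    rw [Subgroup.mem_pointwise_smul_iff_inv_smul_mem, ← inv_mem_iff]
    simpa [mul_assoc] using hh

/-! ### Maximal characters and the boundary -/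

theorem mem_maxSpectrum {χ : σ.Spectrum} : χ ∈ σ.maxSpectrum ↔
    ∀ χ' : σ.Spectrum, (∀ Z, Holds χ Z → Holds χ' Z) → ∀ Z, Holds χ' Z → Holds χ Z := by
  have key : ∀ χ χ' : σ.Spectrum, (∀ Z, Holds χ Z → Holds χ' Z) ↔ filterOf χ ⊆ filterOf χ' := by
    intro χ χ'
    constructor
    · intro h Z hZ
      exact (holds_iff Z.2).1 (h _ ((holds_iff Z.2).2 hZ))
    · rintro h Z ⟨hZ, hZ'⟩
      exact ⟨hZ, h hZ'⟩
  simp only [maxSpectrum, Set.mem_ofPred_eq, key, not_exists, Set.ssubset_def, not_and, not_not]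

theorem translate_mem_maxSpectrum {χ : σ.Spectrum} (hχ : χ ∈ σ.maxSpectrum) (g : G) :
    translate g χ ∈ σ.maxSpectrum := by
  rw [mem_maxSpectrum] at *
  intro χ' h Z hZ
  rw [holds_translate]
  refine hχ (translate g⁻¹ χ') (fun Y hY => ?_) _ ?_
  · rw [holds_translate, inv_inv]
    refine h _ ?_
    rwa [holds_translate, inv_smul_smul]
  · rwa [holds_translate, inv_inv, smul_inv_smul]

/-- Otherwise `X` and the filter of `χ` would generate a strictly larger proper filter. -/
theorem exists_disjoint_of_mem_maxSpectrum {χ : σ.Spectrum} (hχ : χ ∈ σ.maxSpectrum)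
    {X : Set G} (hX : X ∈ σ.idem) (h : ¬ Holds χ X) : ∃ Y, Holds χ Y ∧ X ∩ Y = ∅ := by
  by_contra! h0
  refine h (mem_maxSpectrum.1 hχ
    (ofFilter {Z | ∃ Y, Holds χ Y ∧ X ∩ Y ⊆ Z} ⟨X, ⟨_, holds_univ χ, by simp⟩, hX⟩ ?_ ?_)
    (fun Z hZ => holds_ofFilter.2 ⟨hZ.1, Z, hZ, Set.inter_subset_right⟩) X
    (holds_ofFilter.2 ⟨hX, _, holds_univ χ, by simp⟩))
  · intro Z _ W _
    constructor
    · rintro ⟨Y, hY, hYZ⟩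
      exact ⟨⟨Y, hY, hYZ.trans Set.inter_subset_left⟩, ⟨Y, hY, hYZ.trans Set.inter_subset_right⟩⟩
    · rintro ⟨⟨Y, hY, hYZ⟩, ⟨Y', hY', hYW⟩⟩
      exact ⟨_, hY.inter hY', fun x hx => ⟨hYZ ⟨hx.1, hx.2.1⟩, hYW ⟨hx.1, hx.2.2⟩⟩⟩
  · rintro ⟨Y, hY, hYZ⟩
    exact (h0 Y hY).ne_empty (Set.subset_empty_iff.1 hYZ)

/-- Zorn's lemma above the principal filter at `1`. The resulting `χ` has `𝔉(χ) = 𝒞`, so the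
approximation lemma applies to the maximal characters. -/
theorem exists_mem_maxSpectrum (σ : AlgebraicAction S G) :
    ∃ χ ∈ σ.maxSpectrum, ∀ X ∈ σ.idem, 1 ∈ X → Holds χ X := by
  let χ₁ : σ.Spectrum := ofFilter {X | 1 ∈ X} ⟨_, Set.mem_univ (1 : G), univ_mem_idem⟩
    (fun _ _ _ _ => Iff.rfl) (Set.notMem_empty (1 : G))
  obtain ⟨m, hm, hmax⟩ := zorn_subset_nonempty
    {f : Set (Set G) | ∃ χ : σ.Spectrum, {X | Holds χ X} = f} (by
      intro c hc hchain ⟨f₀, hf₀⟩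
      refine ⟨⋃₀ c, ⟨ofFilter (⋃₀ c) ?_ ?_ ?_, ?_⟩, fun f hf => Set.subset_sUnion_of_mem hf⟩
      · obtain ⟨χ, rfl⟩ := hc hf₀
        exact ⟨_, ⟨_, hf₀, holds_univ χ⟩, univ_mem_idem⟩
      · intro X hX Y hY
        constructor
        · rintro ⟨f, hf, h⟩
          obtain ⟨χ, rfl⟩ := hc hf
          exact ⟨⟨_, hf, Holds.mono h hX Set.inter_subset_left⟩,
            ⟨_, hf, Holds.mono h hY Set.inter_subset_right⟩⟩
        · rintro ⟨⟨f, hf, hX⟩, ⟨f', hf', hY⟩⟩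
          rcases hchain.total hf hf' with h | h
          · obtain ⟨χ, rfl⟩ := hc hf'
            exact ⟨_, hf', Holds.inter (h hX) hY⟩
          · obtain ⟨χ, rfl⟩ := hc hf
            exact ⟨_, hf, Holds.inter hX (h hY)⟩
      · rintro ⟨f, hf, h⟩
        obtain ⟨χ, rfl⟩ := hc hf
        exact Set.not_nonempty_empty (Holds.nonempty h)
      · ext X
        rw [Set.mem_ofPred_eq, holds_ofFilter, and_iff_right_iff_imp]
        rintro ⟨f, hf, h⟩
        obtain ⟨χ, rfl⟩ := hc hf
        exact h.1) {X | Holds χ₁ X} ⟨χ₁, rfl⟩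
  obtain ⟨χ, rfl⟩ := hmax.prop
  refine ⟨χ, mem_maxSpectrum.2 fun χ' h Z hZ => hmax.le_of_ge ⟨χ', rfl⟩ h hZ, fun X hX h1 => ?_⟩
  exact hm (holds_ofFilter.2 ⟨hX, h1⟩)

theorem mem_boundary_of_mem_finHereditaryFilters {ψ : σ.Spectrum}
    (hψ : constructibleFilter ψ ∈ σ.finHereditaryFilters) : ψ ∈ σ.boundary := by
  refine mem_closure_of_constructibleFilter_subset
    (fun χ hχ g => translate_mem_maxSpectrum hχ g) hψ fun C hC => ?_
  obtain ⟨χ, hχ, h⟩ := exists_mem_maxSpectrum σ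
  have hC := hψ.1.constructible C hC
  exact ⟨χ, hχ, mem_constructibleFilter.2
    ⟨hC, 1, h _ (smul_mem_idem hC 1) (mem_smul_subgroup_self C 1)⟩⟩

/-- A member of the cover that `χ` rejects is disjoint from some set `χ` accepts; shrinking `X` to
that set discards it. Not all can be discarded, as accepted sets are non-empty. -/
theorem exists_holds_of_mem_maxSpectrum {χ : σ.Spectrum} (hχ : χ ∈ σ.maxSpectrum)
    {X : Set G} (hX : Holds χ X) (T : Finset (Set G)) (hT : ∀ Y ∈ T, Y ∈ σ.idem)
    (hXT : ∀ x ∈ X, ∃ Y ∈ T, x ∈ Y) : ∃ Y ∈ T, Holds χ Y := by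
  classical
  induction T using Finset.induction_on generalizing X with
  | empty =>
    obtain ⟨x, hx⟩ := hX.nonempty
    simpa using hXT x hx
  | insert Y T _ ih =>
    by_cases hY : Holds χ Y
    · exact ⟨Y, Finset.mem_insert_self _ _, hY⟩
    · obtain ⟨W, hW, hd⟩ := exists_disjoint_of_mem_maxSpectrum hχ
        (hT Y (Finset.mem_insert_self _ _)) hY
      obtain ⟨Z, hZ, h⟩ := ih (hX.inter hW) (fun Z hZ => hT Z (Finset.mem_insert_of_mem hZ))
        fun x hx => by
          obtain ⟨Z, hZ, hxZ⟩ := hXT x hx.1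
          rcases Finset.mem_insert.1 hZ with rfl | hZ
          · exact absurd (hd ▸ ⟨hxZ, hx.2⟩ : x ∈ (∅ : Set G)) (Set.notMem_empty x)
          · exact ⟨Z, hZ, hxZ⟩
      exact ⟨Z, Finset.mem_insert_of_mem hZ, h⟩

/-- If `ψ` selects `gC`, then finitely many cosets of `D` cover `gC`. A maximal character agreeing
with `ψ` on all these sets selects one of them. -/
theorem constructibleFilter_mem_finHereditaryFilters {ψ : σ.Spectrum} (hψ : ψ ∈ σ.boundary) :
    constructibleFilter ψ ∈ σ.finHereditaryFilters := by
  classical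
  refine ⟨isFilter_constructibleFilter ψ, fun C hC D hD _ hfin => ?_⟩
  obtain ⟨hCc, g, hg⟩ := mem_constructibleFilter.1 hC
  obtain ⟨T, hT⟩ := Subgroup.isFiniteRelIndex_iff_exists_finset.1 hfin
  let Y : G → σ.idem := fun t => ⟨(g * t) • (D : Set G), smul_mem_idem hD _⟩
  obtain ⟨χ, hχ, h⟩ := mem_closure_spectrum.1 hψ
    (insert ⟨g • (C : Set G), smul_mem_idem hCc g⟩ (T.image Y))
  obtain ⟨Z, hZ, hZχ⟩ := exists_holds_of_mem_maxSpectrum hχ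
    ((h _ (Finset.mem_insert_self _ _)).2 hg) (T.image fun t => (Y t).1)
    (fun Z hZ => by
      obtain ⟨t, -, rfl⟩ := Finset.mem_image.1 hZ
      exact (Y t).2)
    (fun x hx => by
      obtain ⟨t, ht, h⟩ := hT _ (mem_smul_subgroup.1 hx)
      refine ⟨_, Finset.mem_image_of_mem _ ht, mem_smul_subgroup.2 ?_⟩
      simpa [mul_assoc] using h)
  obtain ⟨t, ht, rfl⟩ := Finset.mem_image.1 hZ
  exact mem_constructibleFilter.2 ⟨hD, g * t,
    (h (Y t) (Finset.mem_insert_of_mem (Finset.mem_image_of_mem _ ht))).1 hZχ⟩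

/-! ### The action of `I` on filters -/

theorem mem_constructibleFilter_act {φ ψ : G ≃. G} (hφ : σ.MemI φ) (h : IsLinearPart ψ φ)
    (χ : σ.Spectrum) (hχ : χ.1 ⟨dom φ, dom_mem_idem hφ⟩ = true) {D P : Subgroup G}
    (hD : σ.IsConstructible D) (hP : σ.IsConstructible P) (hPD : (P : Set G) = preimage ψ D) :
    D ∈ constructibleFilter (act hφ χ hχ) ↔ P ∈ constructibleFilter χ := by
  rw [mem_constructibleFilter, mem_constructibleFilter, and_iff_right hD, and_iff_right hP]
  constructor
  · rintro ⟨g, hg⟩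
    obtain ⟨-, hg⟩ := (holds_act _ _ _).1 hg
    obtain ⟨x, y, hy, hxy⟩ := hg.nonempty
    rw [smul_subgroup_eq_of_mem hy, h.preimage_smul hxy, ← hPD] at hg
    exact ⟨x, hg⟩
  · rintro ⟨a, ha⟩
    obtain ⟨x, hx, y, hxy⟩ := (ha.inter ⟨_, hχ⟩).nonempty
    refine ⟨y, (holds_act _ _ _).2 ⟨smul_mem_idem hD y, ?_⟩⟩
    rwa [h.preimage_smul hxy, ← hPD, ← smul_subgroup_eq_of_mem hx]

/-- For each coset `tD'` met by the range of `ψ`, fix one point `p t` mapped into it. Points of `P`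
with images in the same `tD'` differ from `p t` by an element of `P'`. -/
theorem isFiniteRelIndex_of_preimage {ψ : G ≃. G} (hψ : IsLinearPart ψ ψ)
    {D D' P P' : Subgroup G} (hP : (P : Set G) = preimage ψ D)
    (hP' : (P' : Set G) = preimage ψ D') (h : D'.IsFiniteRelIndex D) :
    P'.IsFiniteRelIndex P := by
  classical
  rw [Subgroup.isFiniteRelIndex_iff_exists_finset] at h ⊢
  obtain ⟨T, hT⟩ := h
  have hp : ∀ t : G, ∃ p : G, ∀ x y, y ∈ ψ x → t⁻¹ * y ∈ D' →
      ∃ q, q ∈ ψ p ∧ t⁻¹ * q ∈ D' := fun t => by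
    by_cases ht : ∃ x y, y ∈ ψ x ∧ t⁻¹ * y ∈ D'
    · obtain ⟨x, y, h, h'⟩ := ht
      exact ⟨x, fun _ _ _ _ => ⟨y, h, h'⟩⟩
    · push Not at ht
      exact ⟨1, fun x y h h' => absurd h' (ht x y h)⟩
  choose p hp using hp
  refine ⟨T.image p, fun c hc => ?_⟩
  obtain ⟨y, hy, hcy⟩ : c ∈ preimage ψ D := hP ▸ hc
  obtain ⟨t, ht, hty⟩ := hT y hy
  obtain ⟨q, hq, htq⟩ := hp t c y hcy hty
  refine ⟨_, Finset.mem_image_of_mem _ ht, ?_⟩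
  rw [← SetLike.mem_coe, hP']
  refine ⟨q⁻¹ * y, ?_, ?_⟩
  · simpa [mul_assoc] using D'.mul_mem (D'.inv_mem htq) hty
  · refine (hψ _ _ hq _ _).1 ?_
    rwa [mul_inv_cancel_left]

theorem act_mem_finHereditaryFilters {φ ψ : G ≃. G} (hφ : σ.MemI φ) (hψ : σ.MemIe ψ)
    (h : IsLinearPart ψ φ) {χ : σ.Spectrum}
    (hχ : χ.1 ⟨dom φ, dom_mem_idem hφ⟩ = true)
    (hF : constructibleFilter χ ∈ σ.finHereditaryFilters) :
    constructibleFilter (act hφ χ hχ) ∈ σ.finHereditaryFilters := by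
  refine ⟨isFilter_constructibleFilter _, fun C hC D hD hDC hfin => ?_⟩
  have hCc := (mem_constructibleFilter.1 hC).1
  obtain ⟨P, hP, hPC⟩ := hψ.preimage_constructible.1 C hCc
  obtain ⟨Q, hQ, hQD⟩ := hψ.preimage_constructible.1 D hD
  rw [mem_constructibleFilter_act hφ h χ hχ hCc hP hPC] at hC
  rw [mem_constructibleFilter_act hφ h χ hχ hD hQ hQD]
  refine hF.2 P hC Q hQ ?_ (isFiniteRelIndex_of_preimage hψ.isLinearPart hPC hQD hfin)
  rw [← SetLike.coe_subset_coe, hPC, hQD]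
  rintro x ⟨y, hy, hxy⟩
  exact ⟨y, hDC hy, hxy⟩

theorem image_eq_preimage_symm {G : Type*} (φ : G ≃. G) (X : Set G) : image φ X = preimage φ.symm X := by
  ext x
  simp only [image, preimage, PEquiv.mem_iff_mem]

/-- This is `𝔉(φ.χ) = ψ.𝔉(χ)`, for any admissible `K`. Minimality: if `D ∈ 𝔉(φ.χ)` then `P = ψ⁻¹(D)`
lies in `𝔉(χ)`, and `ψ(K ∩ P) ⊆ D`. -/
theorem isTranslate_act {φ ψ : G ≃. G} (hφ : σ.MemI φ) (hψ : σ.MemIe ψ)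
    (h : IsLinearPart ψ φ) {χ : σ.Spectrum}
    (hχ : χ.1 ⟨dom φ, dom_mem_idem hφ⟩ = true)
    (hF : constructibleFilter χ ∈ σ.finHereditaryFilters) {K : Subgroup G}
    (hK : K ∈ constructibleFilter χ) (hKψ : (K : Set G) ⊆ dom ψ) :
    IsLeast {E | E ∈ σ.finHereditaryFilters ∧
      ∀ C ∈ constructibleFilter χ, ∃ D ∈ E, (D : Set G) = image ψ ((K : Set G) ∩ C)}
      (constructibleFilter (act hφ χ hχ)) := by
  refine ⟨⟨act_mem_finHereditaryFilters hφ hψ h hχ hF, fun C hC => ?_⟩, fun E ⟨hE, hE'⟩ D hD => ?_⟩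
  · have hKC := hF.1.inf_mem K hK C hC
    obtain ⟨D, hD, hDi⟩ := hψ.preimage_constructible.2 _ (hF.1.constructible _ hKC)
    rw [Subgroup.coe_inf] at hDi
    refine ⟨D, (mem_constructibleFilter_act hφ h χ hχ hD (hF.1.constructible _ hKC) ?_).2 hKC,
      by rw [hDi, image_eq_preimage_symm]⟩
    rw [Subgroup.coe_inf, hDi, ← image_eq_preimage_symm]
    ext x
    constructor
    · intro hx
      obtain ⟨y, hy⟩ := hKψ hx.1
      exact ⟨y, ⟨x, hx, hy⟩, hy⟩
    · rintro ⟨y, ⟨x', hx', hy'⟩, hy⟩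
      rwa [PEquiv.inj _ hy hy']
  · have hDc := (mem_constructibleFilter.1 hD).1
    obtain ⟨P, hP, hPD⟩ := hψ.preimage_constructible.1 D hDc
    rw [mem_constructibleFilter_act hφ h χ hχ hDc hP hPD] at hD
    obtain ⟨D', hD', hDi⟩ := hE' P hD
    refine hE.1.upward D' hD' D hDc ?_
    rw [← SetLike.coe_subset_coe, hDi]
    rintro y ⟨x, ⟨-, hx⟩, hy⟩
    rw [hPD] at hx
    obtain ⟨z, hz, hxz⟩ := hx
    rwa [Option.mem_unique hy hxz]

/-! ### The correspondence -/

theorem IsInvariant.translate_mem {X : Set σ.Spectrum} (hX : IsInvariant X) {χ : σ.Spectrum}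
    (hχ : χ ∈ X) (g : G) : translate g χ ∈ X :=
  hX χ hχ _ _ _

theorem constructibleFilter_translate (g : G) (χ : σ.Spectrum) :
    constructibleFilter (translate g χ) = constructibleFilter χ := by
  ext C
  simp only [mem_constructibleFilter, holds_translate, smul_smul]
  refine and_congr_right fun _ => ⟨fun ⟨h, hh⟩ => ⟨_, hh⟩, fun ⟨h, hh⟩ => ⟨g * h, ?_⟩⟩
  rwa [inv_mul_cancel_left]

theorem mapsTo_constructibleFilter (σ : AlgebraicAction S G) : Set.MapsTo
    (fun X : Set σ.Spectrum => {F | ∃ χ ∈ X, constructibleFilter χ = F})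
    σ.closedInvariantSubspaces σ.invariantClosedFamilies := by
  rintro X ⟨hXb, hXc, hXi⟩
  refine ⟨?_, ?_, ?_⟩
  · rintro _ ⟨χ, hχ, rfl⟩
    exact constructibleFilter_mem_finHereditaryFilters (hXb hχ)
  · rintro _ ⟨χ, hχ, rfl⟩ φ hφ F' ⟨K, hK, hKφ, hF'⟩
    obtain ⟨hKc, g, hg⟩ := mem_constructibleFilter.1 hK
    -- `χ` selects `gK`, so its translate by `g⁻¹` selects `K`, hence `dom φ`, and `φ` can act on
    -- it. The filter is unchanged.
    have hX' := hXi.translate_mem hχ g⁻¹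
    rw [← constructibleFilter_translate g⁻¹] at hK hF'
    have hdom : Holds (translate g⁻¹ χ) (dom φ) := by
      rw [holds_translate, inv_inv]
      exact hg.mono (smul_mem_idem_iff.2 (dom_mem_idem hφ.memI)) (Set.smul_set_mono hKφ)
    have hdom' := (holds_iff (dom_mem_idem hφ.memI)).1 hdom
    exact ⟨act hφ.memI _ hdom', hXi _ hX' _ _ _,
      (isTranslate_act hφ.memI hφ hφ.isLinearPart hdom'
        (constructibleFilter_mem_finHereditaryFilters (hXb hX')) hK hKφ).unique hF'⟩
  · intro E hE hEX
    obtain ⟨ψ, rfl⟩ := hE.1.exists_character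
    refine ⟨ψ, ?_, rfl⟩
    rw [← hXc.closure_eq]
    refine mem_closure_of_constructibleFilter_subset
      (fun χ hχ g => hXi.translate_mem hχ g) hE fun C hC => ?_
    obtain ⟨_, ⟨χ, hχ, rfl⟩, h⟩ := hEX hC
    exact ⟨χ, hχ, h⟩

theorem mapsTo_setOf_constructibleFilter_mem (σ : AlgebraicAction S G) : Set.MapsTo
    (fun Fs : Set (Set (Subgroup G)) =>
      {χ : σ.Spectrum | χ ∈ σ.boundary ∧ constructibleFilter χ ∈ Fs})
    σ.invariantClosedFamilies σ.closedInvariantSubspaces := by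
  rintro Fs ⟨hFs, hinv, hcl⟩
  refine ⟨fun χ hχ => hχ.1, ?_, ?_⟩
  · refine isClosed_of_closure_subset fun ψ hψ => ?_
    have hψb : ψ ∈ σ.boundary :=
      closure_minimal (fun χ hχ => hχ.1) isClosed_closure hψ
    refine ⟨hψb, hcl _ (constructibleFilter_mem_finHereditaryFilters hψb) fun C hC => ?_⟩
    obtain ⟨hCc, g, hg⟩ := mem_constructibleFilter.1 hC
    -- Membership of `C` is witnessed by one value, so `𝔉` of a limit lies in the union of the
    -- approximating filters.
    obtain ⟨χ, hχ, h⟩ := mem_closure_spectrum.1 hψ {⟨g • (C : Set G), smul_mem_idem hCc g⟩}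
    exact ⟨_, hχ.2, mem_constructibleFilter.2
      ⟨hCc, g, (h _ (Finset.mem_singleton_self _)).2 hg⟩⟩
  · rintro χ ⟨hχb, hχF⟩ φ hφ hχ
    obtain ⟨ψ, hψ, h⟩ := hφ.exists_isLinearPart
    have hF := constructibleFilter_mem_finHereditaryFilters hχb
    refine ⟨mem_boundary_of_mem_finHereditaryFilters
      (act_mem_finHereditaryFilters hφ hψ h hχ hF), ?_⟩
    obtain ⟨K, hKc, hK⟩ := hψ.dom_constructible
    have hdom : Holds χ (dom φ) := ⟨_, hχ⟩
    have hKF : K ∈ constructibleFilter χ := by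
      obtain ⟨x, hx⟩ := hdom.nonempty
      refine mem_constructibleFilter.2 ⟨hKc, x, ?_⟩
      rwa [hK, ← h.dom_eq hx]
    exact hinv _ hχF ψ hψ _ ⟨K, hKF, hK.subset, isTranslate_act hφ hψ h hχ hF hKF hK.subset⟩

theorem invOn_constructibleFilter (σ : AlgebraicAction S G) : Set.InvOn
    (fun Fs : Set (Set (Subgroup G)) =>
      {χ : σ.Spectrum | χ ∈ σ.boundary ∧ constructibleFilter χ ∈ Fs})
    (fun X : Set σ.Spectrum => {F | ∃ χ ∈ X, constructibleFilter χ = F})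
    σ.closedInvariantSubspaces σ.invariantClosedFamilies := by
  constructor
  · rintro X ⟨hXb, hXc, hXi⟩
    refine Set.Subset.antisymm ?_ fun χ hχ => ⟨hXb hχ, χ, hχ, rfl⟩
    rintro ψ ⟨hψ, χ, hχ, h⟩
    rw [← hXc.closure_eq]
    -- The single character `χ`, having the same filter as `ψ`, serves for every `C`.
    exact mem_closure_of_constructibleFilter_subset (fun χ hχ g => hXi.translate_mem hχ g)
      (constructibleFilter_mem_finHereditaryFilters hψ) fun C hC => ⟨χ, hχ, h ▸ hC⟩
  · rintro Fs ⟨hFs, -, -⟩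
    refine Set.Subset.antisymm ?_ fun F hF => ?_
    · rintro _ ⟨χ, hχ, rfl⟩
      exact hχ.2
    · obtain ⟨χ, rfl⟩ := (hFs hF).1.exists_character
      exact ⟨χ, ⟨mem_boundary_of_mem_finHereditaryFilters (hFs hF), hF⟩, rfl⟩

end AlgebraicAction

theorem mainTheorem3 {S G : Type*} [Monoid S] [Group G] (σ : AlgebraicAction S G)
    (hσ : σ.NonAutomorphic) :
    Set.BijOn
      (fun X : Set σ.Spectrum => {F | ∃ χ ∈ X, AlgebraicAction.constructibleFilter χ = F})
      σ.closedInvariantSubspaces σ.invariantClosedFamilies ∧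
    Set.MapsTo
      (fun Fs : Set (Set (Subgroup G)) =>
        {χ : σ.Spectrum | χ ∈ σ.boundary ∧ AlgebraicAction.constructibleFilter χ ∈ Fs})
      σ.invariantClosedFamilies σ.closedInvariantSubspaces ∧
    Set.InvOn
      (fun Fs : Set (Set (Subgroup G)) =>
        {χ : σ.Spectrum | χ ∈ σ.boundary ∧ AlgebraicAction.constructibleFilter χ ∈ Fs})
      (fun X : Set σ.Spectrum => {F | ∃ χ ∈ X, AlgebraicAction.constructibleFilter χ = F})
      σ.closedInvariantSubspaces σ.invariantClosedFamilies :=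
  have hmaps := AlgebraicAction.mapsTo_constructibleFilter σ
  have hmaps' := AlgebraicAction.mapsTo_setOf_constructibleFilter_mem σ
  have hinv := AlgebraicAction.invOn_constructibleFilter σ
  ⟨hinv.bijOn hmaps hmaps', hmaps', hinv⟩
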